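/- Let $K$ be a field, $n\ge 1$, and $\mathcal R=K\langle x_1,\dots,x_n\rangle$ the noncommutative polynomial ring; monomials are words in $x_1,\dots,x_n$. An admissible monomial ordering is a total order on words with $1<m$ for $m\neq 1$ and $m_1<m_2\Rightarrow \ell m_1r<\ell m_2r$; $\mathrm{LM}$, $\mathrm{LC}$ denote leading monomials and coefficients. **Involutive divisions.** An involutive division $I$ assigns to every finite set $U$ of monomials and every $u\in U$ a set $\mathcal M^L_I(u,U)$ of left and a set $\mathcal M^R_I(u,U)$ of right multiplicative variables (the others are nonmultiplicative). The monomial $u$ involutively divides $\ell u r$ (as placed there) if the last variable of $\ell$, if it exists, lies in $\mathcal M^L_I(u,U)$ and the first variable of $r$, if it exists, lies in $\mathcal M^R_I(u,U)$; the involutive cone $\mathcal C_I(u,U)$ is the set of all words $\ell ur$ that $u$ involutively divides in this way. $I$ is *strong* if for all finite $U$: (i) two intersecting cones of elements of $U$ are comparable under inclusion; (ii) every $v\in\mathcal C_I(u,U)$ is involutively divisible by $u$ in only one way; (iii) $V\subseteq U$ and $v\in V$ imply $\mathcal M^L_I(v,U)\subseteq\mathcal M^L_I(v,V)$ and $\mathcal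 M^R_I(v,U)\subseteq\mathcal M^R_I(v,V)$. Otherwise $I$ is *weak*. $I$ is *global* if $\mathcal M^L_I(u,U)$ and $\mathcal M^R_I(u,U)$ do not depend on $U$, and *local* otherwise. **Reduction and bases.** A reduction step of $p$ by $g\in P$ replaces $p$ by $p-c\,\mathrm{LC}(g)^{-1}\ell g r$, where $\ell\,\mathrm{LM}(g)\,r$ occurs in $p$ with coefficient $c\ne0$; it is involutive if $\mathrm{LM}(g)$ involutively divides $\ell\,\mathrm{LM}(g)\,r$ as placed there, with respect to $\mathrm{LM}(P)$. A polynomial (involutively) reduces to zero using $P$ if some finite chain of such steps leads to $0$. A finite set $P$ of nonzero polynomials is *autoreduced* if no monomial occurring in a $p\in P$ is involutively divisible, with respect to $\mathrm{LM}(P)$, by $\mathrm{LM}(p')$ for some $p'\in P\setminus\{p\}$. It is a *Locally Involutive Basis* if it is autoreduced and every left prolongation $x_ip$ ($p\in P$, $x_i$ left nonmultiplicative for $\mathrm{LM}(p)$) and every right prolongation $px_i$ ($p\in P$, $x_i$ right nonmultiplicative for $\mathrm{LM}(p)$) involutively reduces to zero using $P$. A finite set $G$ of nonzero polynomials is a *noncommutative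 Gröbner basis* for the two-sided ideal it generates if all S-polynomials $\mathrm{LC}(g_2)\ell_1g_1r_1-\mathrm{LC}(g_1)\ell_2g_2r_2$ reduce to zero using $G$, where $g_1,g_2\in G$, $\ell_1\mathrm{LM}(g_1)r_1=\ell_2\mathrm{LM}(g_2)r_2$, the two leading monomials overlap as placed in this word, $\ell_1=1$ or $\ell_2=1$, and $r_1=1$ or $r_2=1$. A *Gröbner involutive division* is a weak involutive division $I$ such that, for every admissible monomial ordering, every Locally Involutive Basis with respect to $I$ is a noncommutative Gröbner basis. **The left overlap division $\mathcal O$.** For a finite set $U$ of monomials all variables are left multiplicative for every $u\in U$. A variable $x$ is right nonmultiplicative for $v\in U$ exactly when (a) $u=a\,v\,x\,b$ for some $u\in U$ with $u\ne v$ and some words $a,b$; or (b) $v=ap$ and $u=p\,x\,b$ for some $u\in U$ and words $a\neq1$, $p\neq1$, $b$, where either $u=v$ or neither of $u,v$ is a subword of the other. **Proposition.** The left overlap division $\mathcal O$ is a local involutive division, and it is a Gröbner involutive division: it is weak, and for every admissible monomial ordering every Locally Involutive Basis with respect to $\mathcal O$ is a noncommutative Gröbner basis for the two-sided ideal it generates.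 -/

import Mathlib

noncomputable section

namespace NCInvolutive

/-- Monomials in the noncommuting variables `x_0, …, x_{n-1}`: words over `Fin n`. -/
abbrev Word (n : ℕ) := FreeMonoid (Fin n)

/-- The noncommutative polynomial ring `K⟨x_0, …, x_{n-1}⟩`: finitely supported functions from
words to `K`, with the convolution product. -/
abbrev NCPoly (K : Type*) [Field K] (n : ℕ) := MonoidAlgebra K (Word n)

/-! ### Monomial orderings, leading data -/

/-- An admissible monomial ordering: a total order on words with `1 < m` for `m ≠ 1`, compatible
with multiplication on both sides. -/
structure AdmissibleOrder (n : ℕ) extends LinearOrder (Word n) where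
  one_lt' : ∀ m : Word n, m ≠ 1 → lt 1 m
  mul_lt' : ∀ m₁ m₂ l r : Word n, lt m₁ m₂ → lt (l * m₁ * r) (l * m₂ * r)

section Polynomials

variable {K : Type*} [Field K] {n : ℕ}

/-- The leading monomial of `p` (with the irrelevant value `1` at `p = 0`). -/
def leadMon (O : AdmissibleOrder n) (p : NCPoly K n) : Word n :=
  if h : p.coeff.support.Nonempty then @Finset.max' _ O.toLinearOrder p.coeff.support h else 1

/-- The leading coefficient of `p`. -/
def leadCoeff (O : AdmissibleOrder n) (p : NCPoly K n) : K := p.coeff (leadMon O p)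

open Classical in
/-- The set `LM(P)` of leading monomials of a finite set `P` of polynomials. -/
def leadMons (O : AdmissibleOrder n) (P : Finset (NCPoly K n)) : Finset (Word n) :=
  P.image (leadMon O)

/-- The two-sided multiple `l p r` of a polynomial `p` by monomials `l` and `r`. -/
def sandwich (l : Word n) (p : NCPoly K n) (r : Word n) : NCPoly K n :=
  MonoidAlgebra.single l 1 * p * MonoidAlgebra.single r 1

/-- The result of cancelling the term of `p` in the monomial `l · LM(g) · r` with `l g r`. -/
def cancel (O : AdmissibleOrder n) (p g : NCPoly K n) (l r : Word n) : NCPoly K n :=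
  p - (p.coeff (l * leadMon O g * r) * (leadCoeff O g)⁻¹) • sandwich l g r

/-- One step of (conventional) division of `p` by an element of `G`, with result `q`. -/
def ReducesStep (O : AdmissibleOrder n) (G : Finset (NCPoly K n)) (p q : NCPoly K n) : Prop :=
  ∃ g ∈ G, ∃ l r : Word n, p.coeff (l * leadMon O g * r) ≠ 0 ∧ q = cancel O p g l r

/-- `p` reduces to zero using `G`. -/
def ReducesToZero (O : AdmissibleOrder n) (G : Finset (NCPoly K n)) (p : NCPoly K n) : Prop :=
  Relation.ReflTransGen (ReducesStep O G) p 0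

/-! ### Overlaps, S-polynomials, Gröbner bases -/

/-- The monomials `m₁` and `m₂`, placed in the word `l₁ m₁ r₁ = l₂ m₂ r₂`, overlap (they share
at least one letter position), and that word is the overlap word: at least one of `l₁`, `l₂` and
at least one of `r₁`, `r₂` is the unit monomial. Prefix, subword and suffix overlaps as well as
self overlaps are included. -/
def IsOverlap (l₁ m₁ r₁ l₂ m₂ r₂ : Word n) : Prop :=
  l₁ * m₁ * r₁ = l₂ * m₂ * r₂ ∧ (l₁ = 1 ∨ l₂ = 1) ∧ (r₁ = 1 ∨ r₂ = 1) ∧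
    l₂.length < l₁.length + m₁.length ∧ l₁.length < l₂.length + m₂.length

/-- The S-polynomial `LC(p₂) l₁ p₁ r₁ - LC(p₁) l₂ p₂ r₂`. -/
def sPoly (O : AdmissibleOrder n) (l₁ : Word n) (p₁ : NCPoly K n) (r₁ : Word n)
    (l₂ : Word n) (p₂ : NCPoly K n) (r₂ : Word n) : NCPoly K n :=
  leadCoeff O p₂ • sandwich l₁ p₁ r₁ - leadCoeff O p₁ • sandwich l₂ p₂ r₂

/-- A finite set `G` of nonzero polynomials is a noncommutative Gröbner basis for the two-sided
ideal `J`: it generates `J` and all S-polynomials involving members of `G` reduce to zero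
using `G`. -/
structure IsGroebnerBasis (O : AdmissibleOrder n) (G : Finset (NCPoly K n))
    (J : TwoSidedIdeal (NCPoly K n)) : Prop where
  ne_zero : ∀ g ∈ G, g ≠ 0
  span_eq : TwoSidedIdeal.span (G : Set (NCPoly K n)) = J
  sPoly_reduces : ∀ g₁ ∈ G, ∀ g₂ ∈ G, ∀ l₁ r₁ l₂ r₂ : Word n,
    IsOverlap l₁ (leadMon O g₁) r₁ l₂ (leadMon O g₂) r₂ →
      ReducesToZero O G (sPoly O l₁ g₁ r₁ l₂ g₂ r₂)

end Polynomials

/-! ### Involutive divisions -/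

/-- The data of an involutive division: for every finite set `U` of monomials and every `u ∈ U`,
a set of left and a set of right multiplicative variables. (Only values at `u ∈ U` are used.) -/
structure InvolutiveDivision (n : ℕ) where
  left : Finset (Word n) → Word n → Set (Fin n)
  right : Finset (Word n) → Word n → Set (Fin n)

namespace InvolutiveDivision

variable {n : ℕ} (I : InvolutiveDivision n)

/-- Thin divisors: `u` involutively divides `l u r`, as placed there, if the last variable of `l`
(if it exists) is left multiplicative for `u` and the first variable of `r` (if it exists) is
right multiplicative for `u`. -/
def DividesAt (U : Finset (Word n)) (l u r : Word n) : Prop :=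
  (∀ (l' : Word n) (x : Fin n), l = l' * FreeMonoid.of x → x ∈ I.left U u) ∧
    ∀ (x : Fin n) (r' : Word n), r = FreeMonoid.of x * r' → x ∈ I.right U u

/-- The involutive cone of `u` with respect to `U`. -/
def cone (U : Finset (Word n)) (u : Word n) : Set (Word n) :=
  {v | ∃ l r : Word n, v = l * u * r ∧ I.DividesAt U l u r}

/-- Strong involutive divisions: the Disjoint Cones, Unique Divisor and Subset conditions. -/
structure IsStrong : Prop where
  disjoint_cones : ∀ U : Finset (Word n), ∀ u₁ ∈ U, ∀ u₂ ∈ U,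
    (I.cone U u₁ ∩ I.cone U u₂).Nonempty → I.cone U u₁ ⊆ I.cone U u₂ ∨ I.cone U u₂ ⊆ I.cone U u₁
  unique_divisor : ∀ U : Finset (Word n), ∀ u ∈ U, ∀ l r l' r' : Word n,
    l * u * r = l' * u * r' → I.DividesAt U l u r → I.DividesAt U l' u r' → l = l' ∧ r = r'
  subset_left : ∀ U V : Finset (Word n), V ⊆ U → ∀ v ∈ V, I.left U v ⊆ I.left V v
  subset_right : ∀ U V : Finset (Word n), V ⊆ U → ∀ v ∈ V, I.right U v ⊆ I.right V v

/-- An involutive division is weak if some condition for being strong fails. -/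
def IsWeak : Prop := ¬ I.IsStrong

/-- Global divisions: multiplicative variables of `u ∈ U` do not depend on `U`. -/
def IsGlobal : Prop :=
  ∀ (U V : Finset (Word n)) (u : Word n), u ∈ U → u ∈ V →
    I.left U u = I.left V u ∧ I.right U u = I.right V u

/-- Local divisions: those which are not global. -/
def IsLocal : Prop := ¬ I.IsGlobal

variable {K : Type*} [Field K]

/-- One step of involutive division of `p` by an element of `P`, with result `q`. -/
def ReducesStep (O : AdmissibleOrder n) (P : Finset (NCPoly K n)) (p q : NCPoly K n) : Prop :=
  ∃ g ∈ P, ∃ l r : Word n, p.coeff (l * leadMon O g * r) ≠ 0 ∧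
    I.DividesAt (leadMons O P) l (leadMon O g) r ∧ q = cancel O p g l r

/-- `p` involutively reduces to zero using `P`. -/
def ReducesToZero (O : AdmissibleOrder n) (P : Finset (NCPoly K n)) (p : NCPoly K n) : Prop :=
  Relation.ReflTransGen (I.ReducesStep O P) p 0

/-- `P` is autoreduced: no term of a `p ∈ P` is involutively divisible (with respect to `P`) by
some `p' ∈ P` different from `p`. -/
def IsAutoreduced (O : AdmissibleOrder n) (P : Finset (NCPoly K n)) : Prop :=
  ∀ p ∈ P, ∀ p' ∈ P, p' ≠ p → ∀ m ∈ p.coeff.support, m ∉ I.cone (leadMons O P) (leadMon O p')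

/-- Locally involutive bases: autoreduced finite sets of nonzero polynomials all of whose left
and right prolongations involutively reduce to zero. -/
structure IsLocallyInvolutiveBasis (O : AdmissibleOrder n) (P : Finset (NCPoly K n)) : Prop where
  ne_zero : ∀ p ∈ P, p ≠ 0
  autoreduced : I.IsAutoreduced O P
  left_prolongation : ∀ p ∈ P, ∀ x : Fin n, x ∉ I.left (leadMons O P) (leadMon O p) →
    I.ReducesToZero O P (sandwich (FreeMonoid.of x) p 1)
  right_prolongation : ∀ p ∈ P, ∀ x : Fin n, x ∉ I.right (leadMons O P) (leadMon O p) →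
    I.ReducesToZero O P (sandwich 1 p (FreeMonoid.of x))

variable (K) in
/-- Gröbner involutive divisions (over the coefficient field `K`): weak divisions such that, for
every admissible monomial ordering, every locally involutive basis is a Gröbner basis (for the
two-sided ideal it generates). -/
structure IsGroebner : Prop where
  isWeak : I.IsWeak
  isGroebnerBasis : ∀ (O : AdmissibleOrder n) (G : Finset (NCPoly K n)),
    I.IsLocallyInvolutiveBasis O G →
      IsGroebnerBasis O G (TwoSidedIdeal.span (G : Set (NCPoly K n)))

end InvolutiveDivision

/-! ### The left overlap division -/

/-- `v` is a subword of `w` (consecutive letters). -/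
def IsSubword {n : ℕ} (v w : Word n) : Prop := ∃ a b : Word n, w = a * v * b

/-- The variable `x` is right nonmultiplicative for `v` by a subword overlap: it is the letter
following a non-suffix occurrence of `v` in a different element `u` of `U`. -/
def SubwordNonmult {n : ℕ} (U : Finset (Word n)) (v : Word n) (x : Fin n) : Prop :=
  ∃ u ∈ U, u ≠ v ∧ ∃ a b : Word n, u = a * v * FreeMonoid.of x * b

/-- The variable `x` is right nonmultiplicative for `v` by a prefix/suffix overlap: a proper
(nonempty) prefix `p` of some `u ∈ U` is a proper suffix of `v`, and `x` follows `p` in `u`.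
Either `u = v` (self overlap), or neither of `u`, `v` is a subword of the other. -/
def PrefixSuffixNonmult {n : ℕ} (U : Finset (Word n)) (v : Word n) (x : Fin n) : Prop :=
  ∃ u ∈ U, (u = v ∨ (¬ IsSubword u v ∧ ¬ IsSubword v u)) ∧
    ∃ a p b : Word n, a ≠ 1 ∧ p ≠ 1 ∧ v = a * p ∧ u = p * FreeMonoid.of x * b

/-- The left overlap division. -/
def leftOverlap (n : ℕ) : InvolutiveDivision n where
  left _ _ := Set.univ
  right U v := {x | ¬ SubwordNonmult U v x ∧ ¬ PrefixSuffixNonmult U v x}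

end NCInvolutive

end

/-!
The claim that needs an argument is that a locally involutive basis `G` is a Gröbner basis. Call
two multiples `l₁ g₁ r₁` and `l₂ g₂ r₂` of elements of `G` with the same leading word `w` coherent
if, made monic, they differ by a combination of multiples whose leading words are smaller than `w`.
As an admissible ordering is well-founded (`AdmissibleOrder.wellFounded_lt`, from Higman's lemma),
the S-polynomials reduce to zero as soon as any two multiples with equal leading words are coherent
(`reducesToZero_of_mem_below`), and this is `coherent_of_le`.

Since all variables are left multiplicative, autoreducedness says that no leading monomial is a
suffix of another one. So a multiple with leading word `w` is known from the position in `w` at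
which its leading monomial ends. If the letter `x` after this leading monomial `m = LM(g)` is
nonmultiplicative, the involutive reduction of the prolongation `g x` shows that `g x` is coherent
with a multiple whose leading monomial is a suffix of `m x`
(`exists_suffix_of_not_mem_right`): the position moves by one letter. When this is repeated as long
as possible, an involutive multiple is reached. Inside a leading monomial the only involutive
divisor is that monomial itself, so if `m₂` is a subword of `m₁`, then `g₁` is coherent with the
corresponding multiple of `g₂` (`coherent_of_subword`).

Now let `m₁` end before `m₂` in `w`, followed by a multiplicative letter `x`. Disjoint leading
monomials give coherent multiples in any case, and `m₁` does not lie inside `m₂` by condition (a).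
In the remaining case `m₁ = a p` and `m₂ = p x b` with `a, p ≠ 1`, and by condition (b) the
monomials are different and one is a subword of the other. If `m₂ = c m₁ d`, then `g₂` is exchanged
for a multiple of `g₁`, which ends earlier. If `m₁ = c m₂ d` with `c ≠ 1`, then `g₁` is exchanged
for a multiple of `g₂`, which starts later. In both cases the two monomials now span a shorter part
of `w`. Finally `m₁ = m₂ d` is impossible: then `m₁ = a p = p x b d` overlaps itself in `p`, and `x`
is nonmultiplicative for `m₁`.
-/

namespace NCInvolutive

variable {K : Type*} [Field K] {n : ℕ}

/-! ### Admissible orderings are well-founded -/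

namespace AdmissibleOrder

variable (O : AdmissibleOrder n)

theorem mul_le {u v : Word n} (l r : Word n) (h : O.le u v) : O.le (l * u * r) (l * v * r) := by
  let _ := O.toLinearOrder
  rcases eq_or_lt_of_le (show u ≤ v from h) with rfl | h
  · exact le_refl (l * u * r)
  · exact le_of_lt (O.mul_lt' u v l r h)

theorem one_le (u : Word n) : O.le 1 u := by
  let _ := O.toLinearOrder
  rcases eq_or_ne u 1 with rfl | h
  · exact le_refl (1 : Word n)
  · exact le_of_lt (O.one_lt' u h)

/-- An admissible ordering extends the scattered subword relation. -/
theorem le_of_sublist {u v : List (Fin n)} (h : List.SublistForall₂ (· = ·) u v) :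
    O.le (FreeMonoid.ofList u) (FreeMonoid.ofList v) := by
  let _ := O.toLinearOrder
  induction h with
  | nil => exact O.one_le _
  | @cons a b u v hab _ ih =>
    subst hab
    simpa [FreeMonoid.ofList_cons] using O.mul_le (FreeMonoid.of a) 1 ih
  | @cons_right a u v _ ih =>
    have h1 : O.le (FreeMonoid.ofList v) (FreeMonoid.of a * FreeMonoid.ofList v) := by
      simpa using O.mul_le 1 (FreeMonoid.ofList v) (O.one_le (FreeMonoid.of a))
    exact le_trans (show FreeMonoid.ofList u ≤ FreeMonoid.ofList v from ih) h1

/-- By Higman's lemma every sequence of words contains a word that is a scattered subword of a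
later one, so no sequence of words decreases strictly. -/
theorem wellFounded_lt : WellFounded O.lt := by
  let _ := O.toLinearOrder
  rw [wellFounded_iff_isEmpty_descending_chain]
  refine ⟨fun ⟨f, hf⟩ => ?_⟩
  have hanti : StrictAnti f := strictAnti_nat_of_succ_lt hf
  have hpwo := Set.PartiallyWellOrderedOn.partiallyWellOrderedOn_sublistForall₂
    (r := ((· = ·) : Fin n → Fin n → Prop)) (Set.toFinite Set.univ).partiallyWellOrderedOn
  obtain ⟨i, j, hij, hle⟩ := hpwo (fun k => ⟨(f k).toList, fun x _ => Set.mem_univ x⟩)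
  exact absurd (hanti hij) (not_lt_of_ge (O.le_of_sublist hle))

end AdmissibleOrder

/-! ### Leading monomials and two-sided multiples -/

theorem le_leadMon (O : AdmissibleOrder n) {p : NCPoly K n} {v : Word n} (hv : p.coeff v ≠ 0) :
    O.le v (leadMon O p) := by
  have hmem : v ∈ p.coeff.support := Finsupp.mem_support_iff.2 hv
  unfold leadMon
  rw [dif_pos ⟨v, hmem⟩]
  exact @Finset.le_max' _ O.toLinearOrder _ _ hmem

theorem leadCoeff_ne_zero (O : AdmissibleOrder n) {p : NCPoly K n} (hp : p ≠ 0) :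
    leadCoeff O p ≠ 0 := by
  have hne : p.coeff.support.Nonempty := by
    rw [Finsupp.support_nonempty_iff]
    exact fun h => hp (MonoidAlgebra.coeff_eq_zero.1 h)
  unfold leadCoeff leadMon
  rw [dif_pos hne]
  exact Finsupp.mem_support_iff.1 (@Finset.max'_mem _ O.toLinearOrder _ hne)

theorem coeff_sandwich (l : Word n) (p : NCPoly K n) (r v : Word n) :
    (sandwich l p r).coeff (l * v * r) = p.coeff v := by
  simp [sandwich]

theorem exists_of_coeff_sandwich_ne_zero {l : Word n} {p : NCPoly K n} {r u : Word n}
    (h : (sandwich l p r).coeff u ≠ 0) : ∃ v, u = l * v * r ∧ p.coeff v ≠ 0 := by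
  unfold sandwich at h
  by_cases h1 : ∃ d, d * r = u
  · obtain ⟨d, rfl⟩ := h1
    rw [MonoidAlgebra.coeff_mul_single_mul, mul_one] at h
    by_cases h2 : ∃ v, l * v = d
    · obtain ⟨v, rfl⟩ := h2
      exact ⟨v, rfl, by simpa using h⟩
    · exact absurd (MonoidAlgebra.coeff_single_mul_of_forall_mul_ne _ _ fun v hv => h2 ⟨v, hv⟩) h
  · exact absurd (MonoidAlgebra.coeff_mul_single_of_forall_mul_ne _ _ fun v hv => h1 ⟨v, hv⟩) h

theorem sandwich_sandwich (a l : Word n) (p : NCPoly K n) (r b : Word n) :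
    sandwich a (sandwich l p r) b = sandwich (a * l) p (r * b) := by
  have h1 : (MonoidAlgebra.single (a * l) 1 : NCPoly K n) =
      MonoidAlgebra.single a 1 * MonoidAlgebra.single l 1 := by
    simp [MonoidAlgebra.single_mul_single]
  have h2 : (MonoidAlgebra.single (r * b) 1 : NCPoly K n) =
      MonoidAlgebra.single r 1 * MonoidAlgebra.single b 1 := by
    simp [MonoidAlgebra.single_mul_single]
  simp only [sandwich, h1, h2, mul_assoc]

/-- Two-sided multiplication by the monomials `l` and `r`, as a linear map. -/
noncomputable def sandwichLin (l r : Word n) : NCPoly K n →ₗ[K] NCPoly K n :=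
  LinearMap.mulRight K (MonoidAlgebra.single r 1) ∘ₗ LinearMap.mulLeft K (MonoidAlgebra.single l 1)

theorem sandwichLin_apply (l r : Word n) (p : NCPoly K n) :
    sandwichLin l r p = sandwich l p r := rfl

/-- The two-sided multiple `l g r`, normalized to have leading coefficient `1`. -/
noncomputable def monicMul (O : AdmissibleOrder n) (l : Word n) (g : NCPoly K n) (r : Word n) :
    NCPoly K n :=
  (leadCoeff O g)⁻¹ • sandwich l g r

theorem sandwich_monicMul (O : AdmissibleOrder n) (a l : Word n) (g : NCPoly K n) (r b : Word n) :
    sandwich a (monicMul O l g r) b = monicMul O (a * l) g (r * b) := by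
  rw [monicMul, ← sandwichLin_apply, map_smul, sandwichLin_apply, sandwich_sandwich]; rfl

theorem smul_monicMul (O : AdmissibleOrder n) {g : NCPoly K n} (hg : g ≠ 0) (l r : Word n) :
    leadCoeff O g • monicMul O l g r = sandwich l g r := by
  rw [monicMul, smul_inv_smul₀ (leadCoeff_ne_zero O hg)]

theorem coeff_monicMul (O : AdmissibleOrder n) {g : NCPoly K n} (hg : g ≠ 0) (l r : Word n) :
    (monicMul O l g r).coeff (l * leadMon O g * r) = 1 := by
  rw [monicMul, MonoidAlgebra.coeff_smul_apply, coeff_sandwich]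
  exact inv_mul_cancel₀ (leadCoeff_ne_zero O hg)

theorem le_of_coeff_monicMul_ne_zero (O : AdmissibleOrder n) {g : NCPoly K n} {l r u : Word n}
    (h : (monicMul O l g r).coeff u ≠ 0) : O.le u (l * leadMon O g * r) := by
  rw [monicMul, MonoidAlgebra.coeff_smul_apply] at h
  obtain ⟨v, rfl, hv⟩ := exists_of_coeff_sandwich_ne_zero (right_ne_zero_of_smul h)
  exact O.mul_le l r (le_leadMon O hv)

theorem cancel_eq (O : AdmissibleOrder n) (p g : NCPoly K n) (l r : Word n) :
    cancel O p g l r = p - p.coeff (l * leadMon O g * r) • monicMul O l g r := by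
  rw [cancel, monicMul, smul_smul]

/-! ### Combinations of multiples below a word -/

/-- The span of the multiples `l g r` of elements `g` of `G` whose leading word `l LM(g) r` is
strictly smaller than `w`. -/
noncomputable def below (O : AdmissibleOrder n) (G : Finset (NCPoly K n)) (w : Word n) :
    Submodule K (NCPoly K n) :=
  Submodule.span K {f | ∃ g ∈ G, ∃ l r, O.lt (l * leadMon O g * r) w ∧ f = sandwich l g r}

variable {O : AdmissibleOrder n} {G : Finset (NCPoly K n)}

theorem sandwich_mem_below {g : NCPoly K n} (hg : g ∈ G) {l r w : Word n}
    (h : O.lt (l * leadMon O g * r) w) : sandwich l g r ∈ below O G w :=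
  Submodule.subset_span ⟨g, hg, l, r, h, rfl⟩

theorem monicMul_mem_below {g : NCPoly K n} (hg : g ∈ G) {l r w : Word n}
    (h : O.lt (l * leadMon O g * r) w) : monicMul O l g r ∈ below O G w :=
  Submodule.smul_mem _ _ (sandwich_mem_below hg h)

theorem below_mono {v w : Word n} (h : O.le v w) : below O G v ≤ below O G w := by
  let _ := O.toLinearOrder
  refine Submodule.span_mono fun f hf => ?_
  obtain ⟨g, hg, l, r, hlt, rfl⟩ := hf
  exact ⟨g, hg, l, r, lt_of_lt_of_le (show l * leadMon O g * r < v from hlt) h, rfl⟩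

theorem sandwich_mem_below_of_mem {f : NCPoly K n} {w : Word n} (hf : f ∈ below O G w)
    (a b : Word n) : sandwich a f b ∈ below O G (a * w * b) := by
  rw [← sandwichLin_apply]
  induction hf using Submodule.span_induction with
  | mem f hf =>
    obtain ⟨g, hg, l, r, hlt, rfl⟩ := hf
    rw [sandwichLin_apply, sandwich_sandwich]
    refine sandwich_mem_below hg ?_
    have := O.mul_lt' _ _ a b hlt
    simpa only [mul_assoc] using this
  | zero =>
    rw [map_zero]
    exact Submodule.zero_mem _
  | add f₁ f₂ _ _ ih₁ ih₂ =>
    rw [map_add]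
    exact Submodule.add_mem _ ih₁ ih₂
  | smul c f _ ih =>
    rw [map_smul]
    exact Submodule.smul_mem _ _ ih

/-- The multiples `l₁ g₁ r₁` and `l₂ g₂ r₂`, made monic, are congruent modulo combinations of
multiples with leading words smaller than `w`. The notion is meant for multiples with leading word
`w`, which is not part of the definition. -/
def Coherent (O : AdmissibleOrder n) (G : Finset (NCPoly K n)) (w : Word n)
    (l₁ : Word n) (g₁ : NCPoly K n) (r₁ l₂ : Word n) (g₂ : NCPoly K n) (r₂ : Word n) : Prop :=
  monicMul O l₁ g₁ r₁ - monicMul O l₂ g₂ r₂ ∈ below O G w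

theorem Coherent.symm {w l₁ r₁ l₂ r₂ : Word n} {g₁ g₂ : NCPoly K n}
    (h : Coherent O G w l₁ g₁ r₁ l₂ g₂ r₂) : Coherent O G w l₂ g₂ r₂ l₁ g₁ r₁ := by
  have := Submodule.neg_mem _ h
  rwa [neg_sub] at this

theorem Coherent.trans {w l₁ r₁ l₂ r₂ l₃ r₃ : Word n} {g₁ g₂ g₃ : NCPoly K n}
    (h : Coherent O G w l₁ g₁ r₁ l₂ g₂ r₂) (h' : Coherent O G w l₂ g₂ r₂ l₃ g₃ r₃) :
    Coherent O G w l₁ g₁ r₁ l₃ g₃ r₃ := by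
  have := Submodule.add_mem _ h h'
  rwa [sub_add_sub_cancel] at this

theorem Coherent.extend {w l₁ r₁ l₂ r₂ : Word n} {g₁ g₂ : NCPoly K n}
    (h : Coherent O G w l₁ g₁ r₁ l₂ g₂ r₂) (a b : Word n) :
    Coherent O G (a * w * b) (a * l₁) g₁ (r₁ * b) (a * l₂) g₂ (r₂ * b) := by
  have := sandwich_mem_below_of_mem h a b
  rwa [← sandwichLin_apply, map_sub, sandwichLin_apply, sandwichLin_apply, sandwich_monicMul,
    sandwich_monicMul] at this

theorem Coherent.sPoly_mem {w l₁ r₁ l₂ r₂ : Word n} {g₁ g₂ : NCPoly K n}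
    (h : Coherent O G w l₁ g₁ r₁ l₂ g₂ r₂) (h₁ : g₁ ≠ 0) (h₂ : g₂ ≠ 0) :
    sPoly O l₁ g₁ r₁ l₂ g₂ r₂ ∈ below O G w := by
  have := Submodule.smul_mem _ (leadCoeff O g₁ * leadCoeff O g₂) h
  rw [smul_sub, mul_smul _ _ (monicMul O l₂ g₂ r₂), smul_monicMul O h₂, mul_comm, mul_smul,
    smul_monicMul O h₁] at this
  exact this

/-- If all monomials of `t` are smaller than `m`, then `l t g r` is a combination of multiples of `g`
below `l m LM(g) r`. -/
theorem sandwich_mul_mem_below {g : NCPoly K n} (hg : g ∈ G) {m l r : Word n} {t : NCPoly K n}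
    (ht : ∀ v, t.coeff v ≠ 0 → O.lt v m) :
    sandwich l (t * g) r ∈ below O G (l * m * leadMon O g * r) := by
  have : t * g = t.coeff.sum fun v c => c • sandwich v g 1 := by
    conv_lhs => rw [← MonoidAlgebra.sum_coeff_single t]
    rw [Finsupp.sum_mul]
    refine Finsupp.sum_congr fun v _ => ?_
    rw [sandwich, ← MonoidAlgebra.one_def, mul_one, ← smul_mul_assoc, MonoidAlgebra.smul_single,
      smul_eq_mul, mul_one]
  rw [this, ← sandwichLin_apply, map_finsuppSum]
  refine Submodule.sum_mem _ fun v hv => ?_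
  beta_reduce
  rw [map_smul, sandwichLin_apply, sandwich_sandwich, one_mul]
  refine Submodule.smul_mem _ _ (sandwich_mem_below hg ?_)
  have := O.mul_lt' _ _ l (leadMon O g * r) (ht v (Finsupp.mem_support_iff.1 hv))
  simpa only [mul_assoc] using this

/-- If all monomials of `t` are smaller than `m`, then `l g t r` is a combination of multiples of `g`
below `l LM(g) m r`. -/
theorem sandwich_mul_mem_below' {g : NCPoly K n} (hg : g ∈ G) {m l r : Word n} {t : NCPoly K n}
    (ht : ∀ v, t.coeff v ≠ 0 → O.lt v m) :
    sandwich l (g * t) r ∈ below O G (l * leadMon O g * m * r) := by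
  have : g * t = t.coeff.sum fun v c => c • sandwich 1 g v := by
    conv_lhs => rw [← MonoidAlgebra.sum_coeff_single t]
    rw [Finsupp.mul_sum]
    refine Finsupp.sum_congr fun v _ => ?_
    rw [sandwich, ← MonoidAlgebra.one_def, one_mul, ← mul_smul_comm, MonoidAlgebra.smul_single,
      smul_eq_mul, mul_one]
  rw [this, ← sandwichLin_apply, map_finsuppSum]
  refine Submodule.sum_mem _ fun v hv => ?_
  beta_reduce
  rw [map_smul, sandwichLin_apply, sandwich_sandwich, mul_one]
  refine Submodule.smul_mem _ _ (sandwich_mem_below hg ?_)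
  have := O.mul_lt' _ _ (l * leadMon O g) r (ht v (Finsupp.mem_support_iff.1 hv))
  simpa only [mul_assoc] using this

/-- Multiples in which the leading monomials do not overlap are coherent: with `gᵢ = mᵢ + tᵢ`,
`g₁ s m₂ - m₁ s g₂ = t₁ s g₂ - g₁ s t₂`. -/
theorem coherent_of_disjoint {g₁ g₂ : NCPoly K n} (hg₁ : g₁ ∈ G) (hg₂ : g₂ ∈ G) (h₁ : g₁ ≠ 0)
    (h₂ : g₂ ≠ 0) (l s r : Word n) :
    Coherent O G (l * leadMon O g₁ * s * leadMon O g₂ * r)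
      l g₁ (s * leadMon O g₂ * r) (l * leadMon O g₁ * s) g₂ r := by
  let _ := O.toLinearOrder
  set m₁ := leadMon O g₁ with hm₁
  set m₂ := leadMon O g₂ with hm₂
  have tail : ∀ g : NCPoly K n, g ≠ 0 → ∀ a b v,
      (monicMul O a g b - MonoidAlgebra.single (a * leadMon O g * b) 1).coeff v ≠ 0 →
        O.lt v (a * leadMon O g * b) := by
    intro g hg a b v hv
    rw [MonoidAlgebra.coeff_sub, Finsupp.sub_apply] at hv
    rcases eq_or_ne v (a * leadMon O g * b) with rfl | hne
    · exact absurd (by rw [coeff_monicMul O hg]; simp) hv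
    · rw [MonoidAlgebra.coeff_single, Finsupp.single_eq_of_ne hne, sub_zero] at hv
      exact lt_of_le_of_ne (show v ≤ _ from le_of_coeff_monicMul_ne_zero O hv) hne
  set t₁ := monicMul O 1 g₁ s - MonoidAlgebra.single (1 * m₁ * s) 1 with ht₁
  set t₂ := monicMul O s g₂ 1 - MonoidAlgebra.single (s * m₂ * 1) 1 with ht₂
  have e₁ := sandwich_mul_mem_below (l := l) (r := r) hg₂ (tail g₁ h₁ 1 s)
  have e₂ := sandwich_mul_mem_below' (l := l) (r := r) hg₁ (tail g₂ h₂ s 1)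
  have key : monicMul O l g₁ (s * m₂ * r) - monicMul O (l * m₁ * s) g₂ r =
      (leadCoeff O g₂)⁻¹ • sandwich l (t₁ * g₂) r - (leadCoeff O g₁)⁻¹ • sandwich l (g₁ * t₂) r := by
    have c₁ : monicMul O l g₁ (s * m₂ * r) =
        sandwich l (monicMul O 1 g₁ 1 * MonoidAlgebra.single (s * m₂) 1) r := by
      rw [← one_mul (monicMul O 1 g₁ 1 * _), MonoidAlgebra.one_def]
      change _ = sandwich l (MonoidAlgebra.single 1 1 * (monicMul O 1 g₁ 1 * _)) r
      rw [← mul_assoc]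
      change _ = sandwich l (sandwich 1 (monicMul O 1 g₁ 1) (s * m₂)) r
      simp only [sandwich_monicMul, mul_one, one_mul, mul_assoc]
    have c₂ : monicMul O (l * m₁ * s) g₂ r =
        sandwich l (MonoidAlgebra.single (m₁ * s) 1 * monicMul O 1 g₂ 1) r := by
      rw [← mul_one (_ * monicMul O 1 g₂ 1), MonoidAlgebra.one_def]
      change _ = sandwich l (sandwich (m₁ * s) (monicMul O 1 g₂ 1) 1) r
      simp only [sandwich_monicMul, mul_one, one_mul, mul_assoc]
    have d₁ : (leadCoeff O g₂)⁻¹ • (t₁ * g₂) =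
        monicMul O 1 g₁ s * monicMul O 1 g₂ 1 -
          MonoidAlgebra.single (m₁ * s) 1 * monicMul O 1 g₂ 1 := by
      rw [← sub_mul, ht₁, one_mul, monicMul.eq_1 O 1 g₂ 1, sandwich,
        ← MonoidAlgebra.one_def, one_mul, mul_one, mul_smul_comm]
    have d₂ : (leadCoeff O g₁)⁻¹ • (g₁ * t₂) =
        monicMul O 1 g₁ 1 * monicMul O s g₂ 1 -
          monicMul O 1 g₁ 1 * MonoidAlgebra.single (s * m₂) 1 := by
      rw [← mul_sub, ht₂, mul_one, monicMul.eq_1 O 1 g₁ 1, sandwich,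
        ← MonoidAlgebra.one_def, one_mul, mul_one, smul_mul_assoc]
    have mid : monicMul O 1 g₁ s * monicMul O 1 g₂ 1 = monicMul O 1 g₁ 1 * monicMul O s g₂ 1 := by
      simp only [monicMul, sandwich, ← MonoidAlgebra.one_def, one_mul, mul_one, smul_mul_assoc,
        mul_smul_comm, mul_assoc]
    simp only [← sandwichLin_apply] at *
    rw [c₁, c₂, ← map_smul, ← map_smul, d₁, d₂, ← map_sub, ← map_sub, mid]
    congr 1
    abel
  rw [Coherent, key]
  refine Submodule.sub_mem _ (Submodule.smul_mem _ _ ?_) (Submodule.smul_mem _ _ ?_)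
  · simpa only [ht₁, hm₁, hm₂, mul_assoc, one_mul, mul_one] using e₁
  · simpa only [ht₂, hm₁, hm₂, mul_assoc, one_mul, mul_one] using e₂

/-! ### Words -/

/-- Two factorizations of a word: the longer left factor extends the shorter one. -/
theorem exists_eq_mul_of_mul_eq_mul {a b c d : Word n} (h : a * b = c * d)
    (hl : a.length ≤ c.length) : ∃ t, c = a * t ∧ b = t * d := by
  have h' : a.toList ++ b.toList = c.toList ++ d.toList := h
  rcases List.append_eq_append_iff.1 h' with ⟨t, h1, h2⟩ | ⟨t, h1, h2⟩
  · exact ⟨FreeMonoid.ofList t, h1, h2⟩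
  · have hlen : a.toList.length = c.toList.length + t.length := by rw [h1, List.length_append]
    have hl' : a.toList.length ≤ c.toList.length := hl
    have ht : t = [] := List.length_eq_zero_iff.1 (by omega)
    subst ht
    exact ⟨1, by simpa using h1.symm, by simpa using h2.symm⟩

theorem exists_eq_of_mul {w : Word n} (h : w ≠ 1) : ∃ x r, w = FreeMonoid.of x * r := by
  induction w using FreeMonoid.casesOn with
  | one => exact absurd rfl h
  | of_mul x xs => exact ⟨x, xs, rfl⟩

theorem of_mul_inj {x y : Fin n} {r s : Word n}
    (h : FreeMonoid.of x * r = FreeMonoid.of y * s) : x = y ∧ r = s := by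
  have h' : x :: r.toList = y :: s.toList := h
  exact ⟨(List.cons.inj h').1, (List.cons.inj h').2⟩

/-! ### Involutive reduction of a word -/

theorem mem_leadMons {g : NCPoly K n} (hg : g ∈ G) : leadMon O g ∈ leadMons O G := by
  classical exact Finset.mem_image_of_mem _ hg

/-- Let `p` involutively reduce to zero and have no monomial above `w`. If `w` occurs in `p`, then
it is cancelled by one step of the reduction; all other steps use multiples below `w`. -/
theorem exists_monicMul_of_reducesToZero {I : InvolutiveDivision n} (hne : ∀ g ∈ G, g ≠ 0)
    {p : NCPoly K n} (hp : I.ReducesToZero O G p) (w : Word n)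
    (hle : ∀ v, p.coeff v ≠ 0 → O.le v w) :
    (p.coeff w = 0 → p ∈ below O G w) ∧
    (p.coeff w ≠ 0 → ∃ g ∈ G, ∃ l r, l * leadMon O g * r = w ∧
      I.DividesAt (leadMons O G) l (leadMon O g) r ∧
        p - p.coeff w • monicMul O l g r ∈ below O G w) := by
  let _ := O.toLinearOrder
  unfold InvolutiveDivision.ReducesToZero at hp
  induction hp using Relation.ReflTransGen.head_induction_on with
  | refl => simp
  | @head p q hstep _ ih =>
    obtain ⟨g, hg, l, r, hc, hdiv, rfl⟩ := hstep
    rw [cancel_eq] at ih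
    have hlw := hle _ hc
    have hcoeff : ∀ u, (p - p.coeff (l * leadMon O g * r) • monicMul O l g r).coeff u =
        p.coeff u - p.coeff (l * leadMon O g * r) * (monicMul O l g r).coeff u := fun u => rfl
    have hle' : ∀ v, (p - p.coeff (l * leadMon O g * r) • monicMul O l g r).coeff v ≠ 0 →
        O.le v w := by
      intro v hv
      rw [hcoeff] at hv
      by_cases hpv : p.coeff v = 0
      · rw [hpv, zero_sub, neg_ne_zero] at hv
        exact le_trans (show v ≤ _ from le_of_coeff_monicMul_ne_zero O (right_ne_zero_of_mul hv)) hlw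
      · exact hle v hpv
    obtain ⟨ih₀, ih₁⟩ := ih hle'
    rcases eq_or_lt_of_le (show l * leadMon O g * r ≤ w from hlw) with heq | hlt
    · refine ⟨fun h0 => absurd h0 (heq ▸ hc), fun _ => ⟨g, hg, l, r, heq, hdiv, ?_⟩⟩
      rw [heq] at ih₀
      refine ih₀ ?_
      have := coeff_monicMul O (hne g hg) l r
      rw [heq] at this
      rw [MonoidAlgebra.coeff_sub, Finsupp.sub_apply, MonoidAlgebra.coeff_smul_apply, this]
      simp
    · have hmem := Submodule.smul_mem _ (p.coeff (l * leadMon O g * r))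
        (monicMul_mem_below (w := w) hg hlt)
      have h0 : (monicMul O l g r).coeff w = 0 := by
        by_contra hw
        exact absurd hlt (not_lt_of_ge (le_of_coeff_monicMul_ne_zero O hw))
      have hw := hcoeff w
      rw [h0, mul_zero, sub_zero] at hw
      rw [hw] at ih₀ ih₁
      refine ⟨fun h => ?_, fun h => ?_⟩
      · have := Submodule.add_mem _ (ih₀ h) hmem
        rwa [sub_add_cancel] at this
      · obtain ⟨g', hg', l', r', he, hd, hm⟩ := ih₁ h
        refine ⟨g', hg', l', r', he, hd, ?_⟩
        have := Submodule.add_mem _ hm hmem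
        rwa [sub_right_comm, sub_add_cancel] at this

/-! ### Locally involutive bases of the left overlap division -/

/-- Autoreducedness: a leading monomial involutively divisible by another one is equal to it. -/
theorem eq_of_dividesAt (hG : (leftOverlap n).IsLocallyInvolutiveBasis O G) {g g' : NCPoly K n}
    (hg : g ∈ G) (hg' : g' ∈ G) {l r : Word n} (h : leadMon O g = l * leadMon O g' * r)
    (hdiv : (leftOverlap n).DividesAt (leadMons O G) l (leadMon O g') r) :
    g' = g ∧ l = 1 ∧ r = 1 := by
  have heq : g' = g := by
    by_contra hne
    refine hG.autoreduced g hg g' hg' hne _ ?_ ⟨l, r, h, hdiv⟩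
    exact Finsupp.mem_support_iff.2 (leadCoeff_ne_zero O (hG.ne_zero g hg))
  subst heq
  have hlen := congrArg FreeMonoid.length h
  simp only [FreeMonoid.length_mul] at hlen
  exact ⟨rfl, FreeMonoid.length_eq_zero.1 (by omega), FreeMonoid.length_eq_zero.1 (by omega)⟩

/-- As all variables are left multiplicative, only the right cofactor matters. -/
theorem dividesAt_iff {U : Finset (Word n)} {l u r : Word n} :
    (leftOverlap n).DividesAt U l u r ↔
      ∀ (x : Fin n) (r' : Word n), r = FreeMonoid.of x * r' → x ∈ (leftOverlap n).right U u :=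
  and_iff_right fun _ _ _ => Set.mem_univ _

theorem dividesAt_one {U : Finset (Word n)} {l u : Word n} :
    (leftOverlap n).DividesAt U l u 1 :=
  dividesAt_iff.2 fun x r' h => by
    have := congrArg FreeMonoid.length h
    rw [FreeMonoid.length_one, FreeMonoid.length_mul, FreeMonoid.length_of] at this
    omega

/-- The leading monomials of a locally involutive basis form a suffix code, so a place in a word is
determined by where it ends. -/
theorem eq_of_length_eq (hG : (leftOverlap n).IsLocallyInvolutiveBasis O G) {g₁ g₂ : NCPoly K n}
    (hg₁ : g₁ ∈ G) (hg₂ : g₂ ∈ G) {l₁ r₁ l₂ r₂ : Word n}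
    (h : l₁ * leadMon O g₁ * r₁ = l₂ * leadMon O g₂ * r₂)
    (hlen : l₁.length + (leadMon O g₁).length = l₂.length + (leadMon O g₂).length) :
    l₁ = l₂ ∧ g₁ = g₂ ∧ r₁ = r₂ := by
  wlog hle : l₁.length ≤ l₂.length generalizing l₁ r₁ l₂ r₂ g₁ g₂
  · obtain ⟨h1, h2, h3⟩ := this hg₂ hg₁ h.symm hlen.symm (by omega)
    exact ⟨h1.symm, h2.symm, h3.symm⟩
  obtain ⟨t, ht, hr⟩ := exists_eq_mul_of_mul_eq_mul h (by simp [FreeMonoid.length_mul, hlen])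
  have ht1 : t = 1 := by
    have := congrArg FreeMonoid.length ht
    simp only [FreeMonoid.length_mul] at this
    exact FreeMonoid.length_eq_zero.1 (by omega)
  subst ht1
  rw [mul_one] at ht
  obtain ⟨c, hc, hm⟩ := exists_eq_mul_of_mul_eq_mul ht.symm hle
  obtain ⟨h1, h2, -⟩ := eq_of_dividesAt hG hg₁ hg₂ (l := c) (r := 1) (by rw [hm, mul_one])
    dividesAt_one
  subst h2
  exact ⟨by rw [hc, mul_one], h1.symm, by rw [hr, one_mul]⟩

/-- If `x` is nonmultiplicative for the leading monomial `m` of `g`, then `m x` has a suffix in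
`LM(G)`, and this multiple is coherent with `g x`. -/
theorem exists_suffix_of_not_mem_right (hG : (leftOverlap n).IsLocallyInvolutiveBasis O G)
    {g : NCPoly K n} (hg : g ∈ G) {x : Fin n}
    (hx : x ∉ (leftOverlap n).right (leadMons O G) (leadMon O g)) :
    ∃ g' ∈ G, ∃ l, l * leadMon O g' = leadMon O g * FreeMonoid.of x ∧
      Coherent O G (leadMon O g * FreeMonoid.of x) 1 g (FreeMonoid.of x) l g' 1 := by
  have hne := leadCoeff_ne_zero O (hG.ne_zero g hg)
  have hle : ∀ v, (sandwich 1 g (FreeMonoid.of x)).coeff v ≠ 0 →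
      O.le v (leadMon O g * FreeMonoid.of x) := by
    intro v hv
    obtain ⟨u, rfl, hu⟩ := exists_of_coeff_sandwich_ne_zero hv
    simpa using O.mul_le 1 (FreeMonoid.of x) (le_leadMon O hu)
  have hc : (sandwich 1 g (FreeMonoid.of x)).coeff (leadMon O g * FreeMonoid.of x) =
      leadCoeff O g := by
    simpa [leadCoeff] using coeff_sandwich 1 g (FreeMonoid.of x) (leadMon O g)
  obtain ⟨g', hg', l, r, hw, hdiv, hmem⟩ := (exists_monicMul_of_reducesToZero hG.ne_zero
    (hG.right_prolongation g hg x hx) _ hle).2 (hc ▸ hne)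
  rw [hc] at hmem
  have hr : r = 1 := by
    by_contra hr
    obtain ⟨y, s, rfl⟩ := exists_eq_of_mul hr
    -- If `r ≠ 1`, then `LM(g')` divides `LM(g)` involutively, so `g' = g` by autoreducedness and
    -- `x` would be multiplicative.
    have hlen := congrArg FreeMonoid.length hw
    simp only [FreeMonoid.length_mul, FreeMonoid.length_of] at hlen
    obtain ⟨t, ht, hs⟩ := exists_eq_mul_of_mul_eq_mul hw
      (by simp only [FreeMonoid.length_mul]; omega)
    have hdiv' : (leftOverlap n).DividesAt (leadMons O G) l (leadMon O g') t := by
      refine dividesAt_iff.2 fun z t' hz => ?_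
      subst hz
      rw [mul_assoc] at hs
      rw [← (of_mul_inj hs).1]
      exact dividesAt_iff.1 hdiv y s rfl
    obtain ⟨rfl, rfl, rfl⟩ := eq_of_dividesAt hG hg hg' ht hdiv'
    rw [one_mul, ← mul_one (FreeMonoid.of x)] at hs
    rw [← (of_mul_inj hs).1] at hx
    exact hx (dividesAt_iff.1 hdiv y s rfl)
  subst hr
  refine ⟨g', hg', l, by rw [← hw, mul_one], ?_⟩
  have := Submodule.smul_mem _ (leadCoeff O g)⁻¹ hmem
  rw [smul_sub, inv_smul_smul₀ hne] at this
  exact this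

/-- Every multiple is coherent with an involutive one with the same leading word. -/
theorem exists_coherent_dividesAt (hG : (leftOverlap n).IsLocallyInvolutiveBasis O G)
    {w l r : Word n} {g : NCPoly K n} (hg : g ∈ G) (hw : l * leadMon O g * r = w) :
    ∃ g' ∈ G, ∃ l' r', l' * leadMon O g' * r' = w ∧
      (leftOverlap n).DividesAt (leadMons O G) l' (leadMon O g') r' ∧
        Coherent O G w l g r l' g' r' := by
  induction hk : r.length generalizing l g r with
  | zero =>
    obtain rfl := FreeMonoid.length_eq_zero.1 hk
    exact ⟨g, hg, l, 1, hw, dividesAt_one, by simp [Coherent]⟩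
  | succ k ih =>
    obtain ⟨x, s, rfl⟩ := exists_eq_of_mul (w := r) (by rintro rfl; simp at hk)
    by_cases hx : x ∈ (leftOverlap n).right (leadMons O G) (leadMon O g)
    · refine ⟨g, hg, l, _, hw, dividesAt_iff.2 fun y s' h => ?_, by simp [Coherent]⟩
      rwa [← (of_mul_inj h).1]
    · obtain ⟨g₁, hg₁, l₁, he, hcoh⟩ := exists_suffix_of_not_mem_right hG hg hx
      have hext := hcoh.extend l s
      have hw' : l * (leadMon O g * FreeMonoid.of x) * s = w := by rw [← hw]; simp only [mul_assoc]
      rw [hw', mul_one, one_mul] at hext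
      obtain ⟨g', hg', l', r', h1, h2, h3⟩ := ih (l := l * l₁) (r := s) hg₁
        (by rw [← hw', ← he]; simp only [mul_assoc])
        (by simpa [FreeMonoid.length_mul, add_comm] using hk)
      exact ⟨g', hg', l', r', h1, h2, hext.trans h3⟩

/-- If one leading monomial is a subword of another, then the corresponding multiples are
coherent: the only involutive divisor of a leading monomial is itself. -/
theorem coherent_of_subword (hG : (leftOverlap n).IsLocallyInvolutiveBasis O G)
    {g₁ g₂ : NCPoly K n} (hg₁ : g₁ ∈ G) (hg₂ : g₂ ∈ G) {c d : Word n}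
    (h : c * leadMon O g₂ * d = leadMon O g₁) :
    Coherent O G (leadMon O g₁) 1 g₁ 1 c g₂ d := by
  obtain ⟨g', hg', l', r', h1, h2, h3⟩ := exists_coherent_dividesAt hG hg₂ h
  obtain ⟨rfl, rfl, rfl⟩ := eq_of_dividesAt hG hg₁ hg' h1.symm h2
  exact h3.symm

/-- Multiples with the same leading word are coherent. The induction is on the length of the
stretch of the word from the first letter of the two leading monomials to the last one and, for a
fixed length, on the distance between their ends. -/
theorem coherent_of_le (hG : (leftOverlap n).IsLocallyInvolutiveBasis O G)
    {w : Word n} {g₁ g₂ : NCPoly K n} (hg₁ : g₁ ∈ G) (hg₂ : g₂ ∈ G) (l₁ r₁ l₂ r₂ : Word n)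
    (h₁ : l₁ * leadMon O g₁ * r₁ = w) (h₂ : l₂ * leadMon O g₂ * r₂ = w)
    (hle : l₁.length + (leadMon O g₁).length ≤ l₂.length + (leadMon O g₂).length) :
    Coherent O G w l₁ g₁ r₁ l₂ g₂ r₂ := by
  induction hN : l₂.length + (leadMon O g₂).length - min l₁.length l₂.length
    using Nat.strong_induction_on generalizing g₁ g₂ l₁ r₁ l₂ r₂ with | _ N ihN
  induction hD : l₂.length + (leadMon O g₂).length - (l₁.length + (leadMon O g₁).length)
    using Nat.strong_induction_on generalizing g₁ g₂ l₁ r₁ l₂ r₂ with | _ D ihD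
  rcases hle.eq_or_lt with heq | hlt
  · obtain ⟨rfl, rfl, rfl⟩ := eq_of_length_eq hG hg₁ hg₂ (h₁.trans h₂.symm) heq
    simp [Coherent]
  have hw := h₁.trans h₂.symm
  have hlen := congrArg FreeMonoid.length hw
  simp only [FreeMonoid.length_mul] at hlen
  obtain ⟨x, s, rfl⟩ := exists_eq_of_mul (w := r₁) (by rintro rfl; simp at hlen; omega)
  simp only [FreeMonoid.length_mul, FreeMonoid.length_of] at hlen
  by_cases hx : x ∈ (leftOverlap n).right (leadMons O G) (leadMon O g₁)
  swap
  · -- The place of `g₁` moves one letter to the right.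
    obtain ⟨g, hg, l, he, hcoh⟩ := exists_suffix_of_not_mem_right hG hg₁ hx
    have hext := hcoh.extend l₁ s
    have hw' : l₁ * (leadMon O g₁ * FreeMonoid.of x) * s = w := by
      rw [← h₁]; simp only [mul_assoc]
    rw [hw', mul_one, one_mul] at hext
    have hl := congrArg FreeMonoid.length he
    simp only [FreeMonoid.length_mul, FreeMonoid.length_of] at hl
    have hnew : l₁ * l * leadMon O g * s = w := by
      rw [← hw', ← he]; simp only [mul_assoc]
    have hll : (l₁ * l).length = l₁.length + l.length := FreeMonoid.length_mul _ _
    refine hext.trans ?_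
    rcases Nat.lt_or_ge l₁.length (min (l₁ * l).length l₂.length) with hmin | hmin
    · exact ihN _ (by omega) hg hg₂ _ _ _ _ hnew h₂ (by omega) rfl
    · exact ihD _ (by omega) hg hg₂ _ _ _ _ hnew h₂ (by omega) (by omega) rfl
  rcases Nat.lt_or_ge l₂.length (l₁.length + (leadMon O g₁).length) with hov | hdis
  swap
  · -- The two leading monomials are disjoint.
    obtain ⟨t, rfl, ht⟩ := exists_eq_mul_of_mul_eq_mul (hw.trans (mul_assoc _ _ _))
      (by simpa [FreeMonoid.length_mul] using hdis)
    have := coherent_of_disjoint hg₁ hg₂ (hG.ne_zero _ hg₁) (hG.ne_zero _ hg₂) (O := O) l₁ t r₂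
    rw [h₂] at this
    rwa [ht, ← mul_assoc]
  rcases Nat.lt_or_ge l₁.length l₂.length with hlt' | hge
  swap
  · -- `LM(g₁)` lies inside `LM(g₂)` and is followed there by `x`.
    exfalso
    obtain ⟨c, rfl, hc⟩ := exists_eq_mul_of_mul_eq_mul
      ((mul_assoc _ _ _).symm.trans (hw.symm.trans (mul_assoc _ _ _))) hge
    simp only [FreeMonoid.length_mul] at hlen hlt
    obtain ⟨d, hd, -⟩ := exists_eq_mul_of_mul_eq_mul
      (a := c * leadMon O g₁ * FreeMonoid.of x) (b := s) (c := leadMon O g₂) (d := r₂)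
      (by rw [hc]; simp only [mul_assoc])
      (by simp only [FreeMonoid.length_mul, FreeMonoid.length_of]; omega)
    refine hx.1 ⟨_, mem_leadMons hg₂, fun he => ?_, c, d, hd⟩
    have := congrArg FreeMonoid.length hd
    rw [he] at this
    simp only [FreeMonoid.length_mul, FreeMonoid.length_of] at this
    omega
  -- Now `LM(g₁) = a p` and `LM(g₂) = p x b`.
  obtain ⟨a, rfl, ha⟩ := exists_eq_mul_of_mul_eq_mul
    ((mul_assoc _ _ _).symm.trans (hw.trans (mul_assoc _ _ _))) hlt'.le
  simp only [FreeMonoid.length_mul] at hlen hlt hlt' hov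
  obtain ⟨p, hp, hp'⟩ := exists_eq_mul_of_mul_eq_mul ha.symm (by omega)
  have hpl := congrArg FreeMonoid.length hp
  simp only [FreeMonoid.length_mul] at hpl
  obtain ⟨b, hb, -⟩ := exists_eq_mul_of_mul_eq_mul (a := p * FreeMonoid.of x) (b := s)
    (c := leadMon O g₂) (d := r₂) (by rw [hp', mul_assoc])
    (by simp only [FreeMonoid.length_mul, FreeMonoid.length_of]; omega)
  have ha1 : a ≠ 1 := by rintro rfl; simp at hlt'
  have hp1 : p ≠ 1 := by rintro rfl; simp at hpl; omega
  have hcmp := fun h => hx.2 ⟨_, mem_leadMons hg₂, h, a, p, b, ha1, hp1, hp, hb⟩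
  have hne : leadMon O g₂ ≠ leadMon O g₁ := fun h => hcmp (Or.inl h)
  by_cases hsub : IsSubword (leadMon O g₂) (leadMon O g₁)
  · obtain ⟨c, d, hcd⟩ := hsub
    have hcl := congrArg FreeMonoid.length hcd
    simp only [FreeMonoid.length_mul] at hcl
    rcases eq_or_ne c 1 with rfl | hc1
    · -- `LM(g₁) = p x b d` overlaps itself in `p`, so `x` is nonmultiplicative.
      refine absurd ?_ hx.2
      refine ⟨_, mem_leadMons hg₁, Or.inl rfl, a, p, b * d, ha1, hp1, hp, ?_⟩
      rw [hcd, hb]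
      simp only [mul_assoc, one_mul]
    · -- The place of `g₁` is exchanged for that of `g₂` inside it.
      have hc0 : c.length ≠ 0 := fun h => hc1 (FreeMonoid.length_eq_zero.1 h)
      have hext := (coherent_of_subword hG hg₁ hg₂ hcd.symm).extend l₁ (FreeMonoid.of x * s)
      rw [h₁, mul_one, one_mul] at hext
      refine hext.trans (ihN _ ?_ hg₂ hg₂ (l₁ * c) _ _ _ ?_ h₂ ?_ rfl)
      · simp only [FreeMonoid.length_mul] at hN ⊢; omega
      · rw [← h₁, hcd]; simp only [mul_assoc]
      · simp only [FreeMonoid.length_mul]; omega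
  · by_cases hsub' : IsSubword (leadMon O g₁) (leadMon O g₂)
    swap
    · exact absurd (Or.inr ⟨hsub, hsub'⟩) hcmp
    -- The place of `g₂` is exchanged for that of `g₁` inside it.
    obtain ⟨c, d, hcd⟩ := hsub'
    have hcl := congrArg FreeMonoid.length hcd
    simp only [FreeMonoid.length_mul] at hcl
    -- `d ≠ 1` since `LM(g₁)` is not a suffix of `LM(g₂)`; so this place ends strictly earlier.
    have hd0 : d.length ≠ 0 := by
      intro h
      obtain rfl := FreeMonoid.length_eq_zero.1 h
      rw [(eq_of_dividesAt hG hg₂ hg₁ hcd dividesAt_one).1] at hne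
      exact hne rfl
    have hext := (coherent_of_subword hG hg₂ hg₁ hcd.symm).extend (l₁ * a) r₂
    rw [h₂, mul_one, one_mul] at hext
    refine Coherent.trans (ihN _ ?_ hg₁ hg₁ l₁ _ (l₁ * a * c) (d * r₂) h₁ ?_ ?_ rfl) hext.symm
    · simp only [FreeMonoid.length_mul] at hN ⊢; omega
    · rw [← h₂, hcd]; simp only [mul_assoc]
    · simp only [FreeMonoid.length_mul]; omega
theorem coherent_of_eq (hG : (leftOverlap n).IsLocallyInvolutiveBasis O G)
    {w : Word n} {g₁ g₂ : NCPoly K n} (hg₁ : g₁ ∈ G) (hg₂ : g₂ ∈ G) {l₁ r₁ l₂ r₂ : Word n}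
    (h₁ : l₁ * leadMon O g₁ * r₁ = w) (h₂ : l₂ * leadMon O g₂ * r₂ = w) :
    Coherent O G w l₁ g₁ r₁ l₂ g₂ r₂ := by
  rcases le_total (l₁.length + (leadMon O g₁).length) (l₂.length + (leadMon O g₂).length) with h | h
  · exact coherent_of_le hG hg₁ hg₂ _ _ _ _ h₁ h₂ h
  · exact (coherent_of_le hG hg₂ hg₁ _ _ _ _ h₂ h₁ h).symm

/-! ### Reduction to zero -/

/-- If all multiples with equal leading words are coherent, then a nonzero element of `below O G w`
has an expression with a single multiple of maximal leading word. -/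
theorem exists_monicMul_of_mem_below (hne : ∀ g ∈ G, g ≠ 0)
    (hcoh : ∀ g₁ ∈ G, ∀ g₂ ∈ G, ∀ l₁ r₁ l₂ r₂,
      l₁ * leadMon O g₁ * r₁ = l₂ * leadMon O g₂ * r₂ →
        Coherent O G (l₂ * leadMon O g₂ * r₂) l₁ g₁ r₁ l₂ g₂ r₂)
    {w : Word n} {f : NCPoly K n} (hf : f ∈ below O G w) :
    f = 0 ∨ ∃ g ∈ G, ∃ l r, ∃ c : K, O.lt (l * leadMon O g * r) w ∧
      f - c • monicMul O l g r ∈ below O G (l * leadMon O g * r) := by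
  let _ := O.toLinearOrder
  induction hf using Submodule.span_induction with
  | mem f hf =>
    obtain ⟨g, hg, l, r, hlt, rfl⟩ := hf
    refine Or.inr ⟨g, hg, l, r, leadCoeff O g, hlt, ?_⟩
    rw [smul_monicMul O (hne g hg), sub_self]
    exact Submodule.zero_mem _
  | zero => exact Or.inl rfl
  | smul a f _ ih =>
    rcases ih with rfl | ⟨g, hg, l, r, c, hlt, hm⟩
    · exact Or.inl (smul_zero a)
    · refine Or.inr ⟨g, hg, l, r, a * c, hlt, ?_⟩
      rw [mul_smul, ← smul_sub]
      exact Submodule.smul_mem _ _ hm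
  | add f₁ f₂ _ _ ih₁ ih₂ =>
    rcases ih₁ with rfl | ⟨g₁, hg₁, l₁, r₁, c₁, hlt₁, hm₁⟩
    · simpa using ih₂
    rcases ih₂ with rfl | ⟨g₂, hg₂, l₂, r₂, c₂, hlt₂, hm₂⟩
    · rw [add_zero]
      exact Or.inr ⟨g₁, hg₁, l₁, r₁, c₁, hlt₁, hm₁⟩
    -- The summand with the smaller leading word lies below the other one.
    have aux : ∀ {v u : Word n} {f : NCPoly K n} {g : NCPoly K n} {l r : Word n} {c : K}, g ∈ G →
        l * leadMon O g * r = v → O.lt v u → f - c • monicMul O l g r ∈ below O G v →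
          f ∈ below O G u := by
      rintro v u f g l r c hg rfl hlt hm
      have := Submodule.add_mem _ (below_mono (le_of_lt hlt) hm)
        (Submodule.smul_mem _ c (monicMul_mem_below hg hlt))
      rwa [sub_add_cancel] at this
    rcases lt_trichotomy (l₁ * leadMon O g₁ * r₁) (l₂ * leadMon O g₂ * r₂) with hlt | heq | hlt
    · refine Or.inr ⟨g₂, hg₂, l₂, r₂, c₂, hlt₂, ?_⟩
      rw [add_sub_assoc]
      exact Submodule.add_mem _ (aux hg₁ rfl hlt hm₁) hm₂
    · refine Or.inr ⟨g₂, hg₂, l₂, r₂, c₁ + c₂, hlt₂, ?_⟩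
      rw [heq] at hm₁
      have := Submodule.add_mem _ (Submodule.add_mem _ hm₁ hm₂)
        (Submodule.smul_mem _ c₁ (hcoh g₁ hg₁ g₂ hg₂ l₁ r₁ l₂ r₂ heq))
      convert this using 1
      rw [smul_sub, add_smul]
      abel
    · refine Or.inr ⟨g₁, hg₁, l₁, r₁, c₁, hlt₁, ?_⟩
      rw [add_sub_right_comm]
      exact Submodule.add_mem _ hm₁ (aux hg₂ rfl hlt hm₂)

theorem coeff_eq_zero_of_mem_below {w v : Word n} {f : NCPoly K n} (hf : f ∈ below O G w)
    (hv : O.le w v) : f.coeff v = 0 := by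
  let _ := O.toLinearOrder
  induction hf using Submodule.span_induction with
  | mem f hf =>
    obtain ⟨g, hg, l, r, hlt, rfl⟩ := hf
    by_contra h
    obtain ⟨u, rfl, hu⟩ := exists_of_coeff_sandwich_ne_zero h
    exact absurd (lt_of_lt_of_le hlt hv) (not_lt_of_ge (O.mul_le l r (le_leadMon O hu)))
  | zero => simp
  | smul a f _ ih => rw [MonoidAlgebra.coeff_smul_apply, ih, smul_zero]
  | add f₁ f₂ _ _ ih₁ ih₂ => rw [MonoidAlgebra.coeff_add, Finsupp.add_apply, ih₁, ih₂, add_zero]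

/-- If all multiples with equal leading words are coherent, then every combination of multiples
reduces to zero: cancelling its maximal leading word leaves a combination below that word. -/
theorem reducesToZero_of_mem_below (hne : ∀ g ∈ G, g ≠ 0)
    (hcoh : ∀ g₁ ∈ G, ∀ g₂ ∈ G, ∀ l₁ r₁ l₂ r₂,
      l₁ * leadMon O g₁ * r₁ = l₂ * leadMon O g₂ * r₂ →
        Coherent O G (l₂ * leadMon O g₂ * r₂) l₁ g₁ r₁ l₂ g₂ r₂)
    (w : Word n) : ∀ f ∈ below O G w, ReducesToZero O G f := by
  let _ := O.toLinearOrder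
  induction w using O.wellFounded_lt.induction with
  | _ w ih =>
    intro f hf
    rcases exists_monicMul_of_mem_below hne hcoh hf with rfl | ⟨g, hg, l, r, c, hlt, hm⟩
    · exact Relation.ReflTransGen.refl
    have hred := ih _ hlt _ hm
    rcases eq_or_ne c 0 with rfl | hc
    · simpa using hred
    have hcoeff : f.coeff (l * leadMon O g * r) = c := by
      have := coeff_eq_zero_of_mem_below hm (le_refl (l * leadMon O g * r))
      rw [MonoidAlgebra.coeff_sub, Finsupp.sub_apply, MonoidAlgebra.coeff_smul_apply,
        coeff_monicMul O (hne g hg), smul_eq_mul, mul_one, sub_eq_zero] at this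
      exact this
    refine Relation.ReflTransGen.head ⟨g, hg, l, r, by rwa [hcoeff], ?_⟩ hred
    rw [cancel_eq, hcoeff]

theorem isGroebnerBasis_of_isLocallyInvolutiveBasis
    (hG : (leftOverlap n).IsLocallyInvolutiveBasis O G) :
    IsGroebnerBasis O G (TwoSidedIdeal.span (G : Set (NCPoly K n))) where
  ne_zero := hG.ne_zero
  span_eq := rfl
  sPoly_reduces _ hg₁ _ hg₂ _ _ _ _ hov :=
    reducesToZero_of_mem_below hG.ne_zero
      (fun _ h₁ _ h₂ _ _ _ _ h => coherent_of_eq hG h₁ h₂ h rfl) _ _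
      ((coherent_of_eq hG hg₁ hg₂ hov.1 rfl).sPoly_mem (hG.ne_zero _ hg₁) (hG.ne_zero _ hg₂))

/-! ### The left overlap division is local and weak -/

/-- A word of length one has no proper nonempty suffix. -/
theorem not_prefixSuffixNonmult_of {U : Finset (Word n)} {y x : Fin n} :
    ¬ PrefixSuffixNonmult U (FreeMonoid.of y) x := by
  rintro ⟨-, -, -, a, p, -, ha, hp, h, -⟩
  have := congrArg FreeMonoid.length h
  rw [FreeMonoid.length_of, FreeMonoid.length_mul] at this
  have ha' := mt FreeMonoid.length_eq_zero.1 ha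
  have hp' := mt FreeMonoid.length_eq_zero.1 hp
  omega

theorem mem_right_singleton_of (y x : Fin n) :
    x ∈ (leftOverlap n).right {FreeMonoid.of y} (FreeMonoid.of y) :=
  ⟨fun ⟨_, hu, hne, _⟩ => hne (Finset.mem_singleton.1 hu), not_prefixSuffixNonmult_of⟩

/-- The variable `x` is multiplicative for `x` with respect to `{x}`, but not with respect to
`{x, x²}`. -/
theorem leftOverlap_isLocal (hn : 1 ≤ n) : (leftOverlap n).IsLocal := by
  classical
  intro h
  let x : Fin n := ⟨0, hn⟩
  have heq := (h {FreeMonoid.of x} {FreeMonoid.of x, FreeMonoid.of x * FreeMonoid.of x}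
    (FreeMonoid.of x) (by simp) (by simp)).2
  have hx := mem_right_singleton_of x x
  rw [heq] at hx
  refine hx.1 ⟨FreeMonoid.of x * FreeMonoid.of x, by simp, fun he => ?_, 1, 1, by simp⟩
  have := congrArg FreeMonoid.length he
  simp [FreeMonoid.length_mul] at this

/-- With respect to `{x}`, the word `x²` is involutively divisible by `x` in two ways. -/
theorem leftOverlap_isWeak (hn : 1 ≤ n) : (leftOverlap n).IsWeak := by
  intro h
  let x : Fin n := ⟨0, hn⟩
  have := (h.unique_divisor {FreeMonoid.of x} (FreeMonoid.of x) (by simp) 1 (FreeMonoid.of x)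
    (FreeMonoid.of x) 1 (by simp) (dividesAt_iff.2 fun y _ _ => mem_right_singleton_of x y)
    dividesAt_one).1
  have := congrArg FreeMonoid.length this
  simp at this

end NCInvolutive

theorem mainTheorem5 (K : Type*) [Field K] (n : ℕ) (hn : 1 ≤ n) :
    (NCInvolutive.leftOverlap n).IsLocal ∧ (NCInvolutive.leftOverlap n).IsGroebner K := by
  exact ⟨NCInvolutive.leftOverlap_isLocal hn, NCInvolutive.leftOverlap_isWeak hn,
    fun _ _ hG => NCInvolutive.isGroebnerBasis_of_isLocallyInvolutiveBasis hG⟩
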